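/- A function $f$ is called completely monotonic on an interval $I$ if it has derivatives of all orders on $I$ and $(-1)^n f^{(n)}(x)\ge 0$ for all $x\in I$ and all integers $n\ge 0$. Let $\psi(x)=\Gamma'(x)/\Gamma(x)$ be the digamma function, where $\Gamma$ is Euler's gamma function, and let $\lambda\in\mathbb{R}$. Then the function $$ x\mapsto \psi'(x)-\frac{\lambda\,(4+8x+5x^2)}{24x(1+x)^3(2+x)^2}-\frac{24+120x+283x^2+399x^3+345x^4+181x^5+51x^6+6x^7}{6x^2(1+x)^4(2+x)^2} $$ is completely monotonic on $(0,\infty)$ if and only if $\lambda\le 0$, and its negative is completely monotonic on $(0,\infty)$ if and only if $\lambda\ge 4$. -/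

import Mathlib

open scoped ContDiff

/-- `f` is completely monotonic on the (nondegenerate) interval `I`: it has derivatives of all
orders on `I`, and `0 ≤ (-1) ^ n * f⁽ⁿ⁾(x)` for every `x ∈ I` and every `n ≥ 0`. -/
def CompletelyMonotonicOn (f : ℝ → ℝ) (I : Set ℝ) : Prop :=
  ContDiffOn ℝ ∞ f I ∧ ∀ n : ℕ, ∀ x ∈ I, 0 ≤ (-1 : ℝ) ^ n * iteratedDerivWithin n f I x

/-- The psi (digamma) function `ψ(x) = Γ'(x) / Γ(x)` of a real variable. -/
noncomputable def psi (x : ℝ) : ℝ := deriv Real.Gamma x / Real.Gamma x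

/-- The function
`ψ'(x) - λ (4 + 8x + 5x²) / (24 x (1+x)³ (2+x)²) - (24 + ⋯ + 6x⁷) / (6 x² (1+x)⁴ (2+x)²)`. -/
noncomputable def trigammaDiff (lam : ℝ) (x : ℝ) : ℝ :=
  deriv psi x
    - lam * (4 + 8 * x + 5 * x ^ 2) / (24 * x * (1 + x) ^ 3 * (2 + x) ^ 2)
    - (24 + 120 * x + 283 * x ^ 2 + 399 * x ^ 3 + 345 * x ^ 4 + 181 * x ^ 5 + 51 * x ^ 6
        + 6 * x ^ 7) / (6 * x ^ 2 * (1 + x) ^ 4 * (2 + x) ^ 2)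

/-!
A completely monotonic function on `(0, ∞)` satisfies `-f'(x) (x - y) ≤ f(y)` for `y < x`, so a
pointwise convergent series of such functions can be differentiated term by term and has a
completely monotonic sum. Hence, if `f → 0` at infinity and `x ↦ f x - f (x + 1)` is completely
monotonic, so is `f`, being the sum of the shifts of this difference.

Convexity of `log Γ` gives `0 ≤ log x - ψ x ≤ 1 / x`, and the difference criterion shows that
`log - ψ` is completely monotonic; therefore `ψ'` is smooth and tends to `0` at infinity. Since
`ψ' x - ψ' (x + 1) = 1 / x²`, the difference `f_λ x - f_λ (x + 1)` of `f_λ = trigammaDiff λ` is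
rational, and for `λ = 0` (respectively, after a change of sign, `λ = 4`) it is a nonnegative
combination of products of the functions `1 / (x + a)`, `a ≥ 0`. All other `λ` for which complete
monotonicity is claimed are reached by adding a nonnegative multiple of `trigammaWeight`.

Conversely, `x f_λ(x) → -λ / 24` as `x → 0⁺`, so `f_λ ≥ 0` forces `λ ≤ 0`; and
`x⁵ (f_λ(x) - f_λ(x + 1)) → 5 (4 - λ) / 6` as `x → ∞`, so for `λ < 4` the function `f_λ` eventually
decreases strictly along unit steps towards `0`, hence is positive there.
-/

open Set Filter Topology

namespace CompletelyMonotonicOn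

variable {f g : ℝ → ℝ} {I J : Set ℝ}

theorem nonneg (hf : CompletelyMonotonicOn f I) {x : ℝ} (hx : x ∈ I) : 0 ≤ f x := by
  simpa using hf.2 0 x hx

theorem congr (hf : CompletelyMonotonicOn f I) (h : EqOn g f I) : CompletelyMonotonicOn g I := by
  refine ⟨hf.1.congr h, fun n x hx => ?_⟩
  rw [iteratedDerivWithin_congr h hx]
  exact hf.2 n x hx

theorem const {c : ℝ} (hc : 0 ≤ c) : CompletelyMonotonicOn (fun _ => c) I := by
  refine ⟨contDiffOn_const, fun n x _ => ?_⟩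
  rw [iteratedDerivWithin_const]
  split_ifs with hn <;> simp [hn, hc]

theorem const_mul (hf : CompletelyMonotonicOn f I) {c : ℝ} (hc : 0 ≤ c) :
    CompletelyMonotonicOn (fun x => c * f x) I := by
  refine ⟨contDiffOn_const.mul hf.1, fun n x hx => ?_⟩
  rw [iteratedDerivWithin_const_mul_field, mul_left_comm]
  exact mul_nonneg hc (hf.2 n x hx)

theorem add (hI : UniqueDiffOn ℝ I) (hf : CompletelyMonotonicOn f I)
    (hg : CompletelyMonotonicOn g I) : CompletelyMonotonicOn (fun x => f x + g x) I := by
  refine ⟨hf.1.add hg.1, fun n x hx => ?_⟩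
  rw [iteratedDerivWithin_fun_add hx hI ((hf.1 x hx).of_le (mod_cast le_top))
    ((hg.1 x hx).of_le (mod_cast le_top)), mul_add]
  exact add_nonneg (hf.2 n x hx) (hg.2 n x hx)

theorem mul (hI : UniqueDiffOn ℝ I) (hf : CompletelyMonotonicOn f I)
    (hg : CompletelyMonotonicOn g I) : CompletelyMonotonicOn (fun x => f x * g x) I := by
  refine ⟨hf.1.mul hg.1, fun n x hx => ?_⟩
  have leibniz := iteratedDerivWithin_mul (n := n) hx hI
    ((hf.1 x hx).of_le (mod_cast le_top)) ((hg.1 x hx).of_le (mod_cast le_top))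
  change 0 ≤ (-1 : ℝ) ^ n * iteratedDerivWithin n (f * g) I x
  rw [leibniz, Finset.mul_sum]
  refine Finset.sum_nonneg fun i hi => ?_
  have sign_split : (-1 : ℝ) ^ n = (-1) ^ i * (-1) ^ (n - i) := by
    rw [← pow_add, Nat.add_sub_cancel' (Finset.mem_range_succ_iff.1 hi)]
  have term_nonneg := mul_nonneg (Nat.cast_nonneg (α := ℝ) (n.choose i))
    (mul_nonneg (hf.2 i x hx) (hg.2 (n - i) x hx))
  rw [sign_split]
  linarith

theorem pow (hI : UniqueDiffOn ℝ I) (hf : CompletelyMonotonicOn f I) (k : ℕ) :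
    CompletelyMonotonicOn (fun x => f x ^ k) I := by
  induction k with
  | zero => simpa only [pow_zero] using const zero_le_one
  | succ k ih => simpa only [pow_succ] using ih.mul hI hf

theorem of_hasDerivAt_neg_succ (hI : IsOpen I) {h : ℕ → ℝ → ℝ}
    (hd : ∀ n, ∀ x ∈ I, HasDerivAt (h n) (-h (n + 1) x) x) (hnn : ∀ n, ∀ x ∈ I, 0 ≤ h n x)
    (n : ℕ) : CompletelyMonotonicOn (h n) I := by
  have iteratedDeriv_eq : ∀ m, EqOn (iteratedDerivWithin m (h n) I)
      (fun x => (-1) ^ m * h (n + m) x) I := by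
    intro m
    induction m with
    | zero => intro x _; simp
    | succ m ih =>
      intro x hx
      rw [iteratedDerivWithin_succ, derivWithin_congr ih (ih hx),
        ((hd (n + m) x hx).const_mul _).hasDerivWithinAt.derivWithin (hI.uniqueDiffWithinAt hx)]
      ring_nf
  refine ⟨contDiffOn_of_differentiableOn_deriv (n := ⊤) fun m _ => ?_, fun m x hx => ?_⟩
  · exact DifferentiableOn.congr (fun x hx =>
      ((hd (n + m) x hx).const_mul _).differentiableAt.differentiableWithinAt) (iteratedDeriv_eq m)
  · rw [iteratedDeriv_eq m hx, ← mul_assoc, ← mul_pow, neg_one_mul, neg_neg, one_pow, one_mul]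
    exact hnn (n + m) x hx

theorem exists_hasDerivAt_neg_succ (hI : IsOpen I) (hf : CompletelyMonotonicOn f I) :
    ∃ h : ℕ → ℝ → ℝ, h 0 = f ∧ (∀ n, CompletelyMonotonicOn (h n) I) ∧
      ∀ n, ∀ x ∈ I, HasDerivAt (h n) (-h (n + 1) x) x := by
  have hd : ∀ n, ∀ x ∈ I, HasDerivAt (fun y => (-1 : ℝ) ^ n * iteratedDerivWithin n f I y)
      (-((-1) ^ (n + 1) * iteratedDerivWithin (n + 1) f I x)) x := by
    intro n x hx
    have diff := hf.1.differentiableOn_iteratedDerivWithin (m := n)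
      (mod_cast ENat.natCast_lt_top n) hI.uniqueDiffOn x hx
    refine ((diff.hasDerivWithinAt.hasDerivAt (hI.mem_nhds hx)).const_mul _).congr_deriv ?_
    rw [iteratedDerivWithin_succ]
    ring
  exact ⟨fun n x => (-1) ^ n * iteratedDerivWithin n f I x, by simp,
    of_hasDerivAt_neg_succ hI hd hf.2, hd⟩

theorem hasDerivAt (hI : IsOpen I) (hf : CompletelyMonotonicOn f I) {x : ℝ} (hx : x ∈ I) :
    HasDerivAt f (deriv f x) x :=
  ((hf.1.differentiableOn (by simp)).differentiableAt (hI.mem_nhds hx)).hasDerivAt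

theorem neg_deriv (hI : IsOpen I) (hf : CompletelyMonotonicOn f I) :
    CompletelyMonotonicOn (fun x => -deriv f x) I := by
  obtain ⟨h, rfl, hcm, hd⟩ := hf.exists_hasDerivAt_neg_succ hI
  exact (hcm 1).congr fun x hx => by simp [(hd 0 x hx).deriv]

theorem of_hasDerivAt_neg (hI : IsOpen I) (hd : ∀ x ∈ I, HasDerivAt f (-g x) x)
    (hf : ∀ x ∈ I, 0 ≤ f x) (hg : CompletelyMonotonicOn g I) : CompletelyMonotonicOn f I := by
  obtain ⟨h, rfl, hcm, hhd⟩ := hg.exists_hasDerivAt_neg_succ hI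
  refine of_hasDerivAt_neg_succ (h := fun | 0 => f | n + 1 => h n) hI ?_ ?_ 0
  · rintro (_ | n)
    exacts [hd, hhd n]
  · rintro (_ | n)
    exacts [hf, fun x hx => (hcm n).nonneg hx]

theorem comp_add_const (hI : IsOpen I) (hJ : IsOpen J) (hf : CompletelyMonotonicOn f I) {c : ℝ}
    (hc : MapsTo (· + c) J I) : CompletelyMonotonicOn (fun x => f (x + c)) J := by
  obtain ⟨h, rfl, hcm, hd⟩ := hf.exists_hasDerivAt_neg_succ hI
  exact of_hasDerivAt_neg_succ (h := fun n x => h n (x + c)) hJ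
    (fun n x hx => (hd n (x + c) (hc hx)).comp_add_const x c)
    (fun n x hx => (hcm n).nonneg (hc hx)) 0

theorem antitoneOn (hI : IsOpen I) (hIc : Convex ℝ I) (hf : CompletelyMonotonicOn f I) :
    AntitoneOn f I := by
  refine antitoneOn_of_deriv_nonpos hIc hf.1.continuousOn ?_ ?_ <;> rw [hI.interior_eq]
  · exact hf.1.differentiableOn (by simp)
  · exact fun x hx => neg_nonneg.1 ((hf.neg_deriv hI).nonneg hx)

theorem neg_deriv_mul_sub_le (hI : IsOpen I) (hIc : Convex ℝ I) (hf : CompletelyMonotonicOn f I)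
    {x y : ℝ} (hy : y ∈ I) (hx : x ∈ I) (hyx : y < x) : -deriv f x * (x - y) ≤ f y := by
  have hsub : Icc y x ⊆ I := hIc.ordConnected.out hy hx
  obtain ⟨c, hc, slope_eq⟩ := exists_deriv_eq_slope f hyx (hf.1.continuousOn.mono hsub)
    ((hf.1.differentiableOn (by simp)).mono (Ioo_subset_Icc_self.trans hsub))
  rw [eq_div_iff (sub_pos.2 hyx).ne'] at slope_eq
  calc -deriv f x * (x - y)
      ≤ -deriv f c * (x - y) := mul_le_mul_of_nonneg_right
        ((hf.neg_deriv hI).antitoneOn hI hIc (hsub (Ioo_subset_Icc_self hc)) hx hc.2.le)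
        (sub_pos.2 hyx).le
    _ = f y - f x := by rw [neg_mul, slope_eq, neg_sub]
    _ ≤ f y := sub_le_self _ (hf.nonneg hx)

theorem tendsto_deriv_atTop {a : ℝ} (hf : CompletelyMonotonicOn f (Ioi a)) :
    Tendsto (deriv f) atTop (𝓝 0) := by
  have ha : a + 1 ∈ Ioi a := lt_add_one a
  suffices Tendsto (fun x => -deriv f x) atTop (𝓝 0) by simpa using this.neg
  have hbound : Tendsto (fun x => f (a + 1) / (x - (a + 1))) atTop (𝓝 0) :=
    tendsto_const_nhds.div_atTop (tendsto_atTop_add_const_right _ _ tendsto_id)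
  refine squeeze_zero' ?_ ?_ hbound
  · filter_upwards [eventually_gt_atTop a] with x hx using (hf.neg_deriv isOpen_Ioi).nonneg hx
  · filter_upwards [eventually_gt_atTop (a + 1)] with x hx
    rw [le_div_iff₀ (sub_pos.2 hx)]
    exact hf.neg_deriv_mul_sub_le isOpen_Ioi (convex_Ioi a) ha (ha.trans hx) hx

section Series

variable {ι : Type*} {F : ι → ℝ → ℝ}

theorem summable_neg_deriv (hI : IsOpen I) (hIc : Convex ℝ I)
    (hF : ∀ i, CompletelyMonotonicOn (F i) I) (hs : ∀ x ∈ I, Summable fun i => F i x)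
    {x : ℝ} (hx : x ∈ I) : Summable fun i => -deriv (F i) x := by
  obtain ⟨y, hyx, hyI⟩ := exists_Ioc_subset_of_mem_nhds (hI.mem_nhds hx) (exists_lt x)
  obtain ⟨z, hyz, hzx⟩ := exists_between hyx
  have hz : z ∈ I := hyI ⟨hyz, hzx.le⟩
  refine Summable.of_nonneg_of_le (fun i => ((hF i).neg_deriv hI).nonneg hx) (fun i => ?_)
    ((hs z hz).div_const (x - z))
  rw [le_div_iff₀ (sub_pos.2 hzx)]
  exact (hF i).neg_deriv_mul_sub_le hI hIc hz hx hzx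

theorem hasDerivAt_tsum (hI : IsOpen I) (hIc : Convex ℝ I)
    (hF : ∀ i, CompletelyMonotonicOn (F i) I) (hs : ∀ x ∈ I, Summable fun i => F i x)
    {x : ℝ} (hx : x ∈ I) :
    HasDerivAt (fun y => ∑' i, F i y) (-∑' i, -deriv (F i) x) x := by
  obtain ⟨y, hyx, hyI⟩ := exists_Ioc_subset_of_mem_nhds (hI.mem_nhds hx) (exists_lt x)
  obtain ⟨z, hyz, hzx⟩ := exists_between hyx
  have hz : z ∈ I := hyI ⟨hyz, hzx.le⟩
  have hbound : ∀ i, ∀ w ∈ I ∩ Ioi z, ‖deriv (F i) w‖ ≤ -deriv (F i) z := by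
    intro i w hw
    have hcm := (hF i).neg_deriv hI
    rw [← norm_neg, Real.norm_of_nonneg (hcm.nonneg hw.1)]
    exact hcm.antitoneOn hI hIc hz hw.1 hw.2.le
  rw [tsum_neg, neg_neg]
  exact hasDerivAt_tsum_of_isPreconnected (summable_neg_deriv hI hIc hF hs hz)
    (hI.inter isOpen_Ioi) (hIc.inter (convex_Ioi z)).isPreconnected
    (fun i w hw => (hF i).hasDerivAt hI hw.1) hbound ⟨hx, hzx⟩ (hs x hx) ⟨hx, hzx⟩

theorem tsum (hI : IsOpen I) (hIc : Convex ℝ I) (hF : ∀ i, CompletelyMonotonicOn (F i) I)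
    (hs : ∀ x ∈ I, Summable fun i => F i x) :
    CompletelyMonotonicOn (fun x => ∑' i, F i x) I := by
  choose h h_zero hcm hd using fun i => (hF i).exists_hasDerivAt_neg_succ hI
  have h_succ : ∀ i n, ∀ x ∈ I, -deriv (h i n) x = h i (n + 1) x := fun i n x hx => by
    rw [(hd i n x hx).deriv, neg_neg]
  have hsum : ∀ n, ∀ x ∈ I, Summable fun i => h i n x := by
    intro n
    induction n with
    | zero => simpa only [h_zero] using hs
    | succ n ih =>
      exact fun x hx => (summable_neg_deriv hI hIc (hcm · n) ih hx).congr fun i => h_succ i n x hx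
  have hcm_tsum := of_hasDerivAt_neg_succ (h := fun n x => ∑' i, h i n x) hI
    (fun n x hx => by
      simpa only [h_succ _ n x hx] using hasDerivAt_tsum hI hIc (hcm · n) (hsum n) hx)
    (fun n x hx => tsum_nonneg fun i => (hcm i n).nonneg hx) 0
  simpa only [h_zero] using hcm_tsum

end Series

end CompletelyMonotonicOn

theorem hasSum_sub_shift {f : ℝ → ℝ} {x : ℝ} (h0 : Tendsto f atTop (𝓝 0))
    (h : ∀ k : ℕ, 0 ≤ f (x + k) - f (x + k + 1)) :
    HasSum (fun k : ℕ => f (x + k) - f (x + k + 1)) (f x) := by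
  have partial_sum : ∀ n : ℕ,
      ∑ k ∈ Finset.range n, (f (x + k) - f (x + k + 1)) = f x - f (x + n) := fun n => by
    simpa [add_assoc] using Finset.sum_range_sub' (fun k : ℕ => f (x + k)) n
  rw [hasSum_iff_tendsto_nat_of_nonneg h]
  simpa [partial_sum] using
    (h0.comp (tendsto_atTop_add_const_left _ x tendsto_natCast_atTop_atTop)).const_sub (f x)

theorem CompletelyMonotonicOn.of_sub_shift {f : ℝ → ℝ} {a : ℝ} (h0 : Tendsto f atTop (𝓝 0))
    (hg : CompletelyMonotonicOn (fun x => f x - f (x + 1)) (Ioi a)) :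
    CompletelyMonotonicOn f (Ioi a) := by
  have mapsTo : ∀ k : ℕ, MapsTo (· + (k : ℝ)) (Ioi a) (Ioi a) := fun k x hx =>
    mem_Ioi.2 (lt_add_of_lt_of_nonneg hx k.cast_nonneg)
  have hsum : ∀ x ∈ Ioi a, HasSum (fun k : ℕ => f (x + k) - f (x + k + 1)) (f x) :=
    fun x hx => hasSum_sub_shift h0 fun k => hg.nonneg (mapsTo k hx)
  exact (tsum isOpen_Ioi (convex_Ioi a) (F := fun (k : ℕ) x => f (x + k) - f (x + k + 1))
    (fun k => hg.comp_add_const isOpen_Ioi isOpen_Ioi (mapsTo k))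
    fun x hx => (hsum x hx).summable).congr fun x hx => (hsum x hx).tsum_eq.symm

theorem pos_of_forall_shift_lt {f : ℝ → ℝ} {x : ℝ} (h0 : Tendsto f atTop (𝓝 0))
    (h : ∀ y, x ≤ y → f (y + 1) < f y) : 0 < f x := by
  have term_pos : ∀ k : ℕ, 0 < f (x + k) - f (x + k + 1) := fun k =>
    sub_pos.2 (h _ (le_add_of_nonneg_right k.cast_nonneg))
  have hsum := hasSum_sub_shift h0 fun k => (term_pos k).le
  rw [← hsum.tsum_eq]
  exact hsum.summable.tsum_pos (fun k => (term_pos k).le) 0 (term_pos 0)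

theorem tendsto_atTop_of_eq_comp_inv {f φ : ℝ → ℝ} (hφ : ContinuousAt φ 0)
    (h : ∀ x, 0 < x → f x = φ x⁻¹) : Tendsto f atTop (𝓝 (φ 0)) := by
  refine (hφ.tendsto.comp tendsto_inv_atTop_zero).congr' ?_
  filter_upwards [eventually_gt_atTop 0] with x hx using (h x hx).symm

theorem completelyMonotonicOn_inv : CompletelyMonotonicOn (fun x => x⁻¹) (Ioi 0) := by
  have hd : ∀ n : ℕ, ∀ x ∈ Ioi (0 : ℝ), HasDerivAt (fun x : ℝ => n.factorial * x⁻¹ ^ (n + 1))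
      (-((n + 1).factorial * x⁻¹ ^ (n + 1 + 1))) x := by
    intro n x hx
    refine (((hasDerivAt_inv (ne_of_gt hx)).fun_pow (n + 1)).const_mul _).congr_deriv ?_
    rw [Nat.factorial_succ, Nat.add_sub_cancel, ← inv_pow]
    push_cast
    ring
  simpa using CompletelyMonotonicOn.of_hasDerivAt_neg_succ
    (h := fun n x => n.factorial * x⁻¹ ^ (n + 1)) isOpen_Ioi hd
    (fun n x hx => mul_nonneg n.factorial.cast_nonneg (pow_nonneg (inv_nonneg.2 (le_of_lt hx)) _)) 0

theorem completelyMonotonicOn_inv_add {a : ℝ} (ha : 0 ≤ a) :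
    CompletelyMonotonicOn (fun x => (x + a)⁻¹) (Ioi 0) :=
  completelyMonotonicOn_inv.comp_add_const isOpen_Ioi isOpen_Ioi fun _ hx =>
    lt_add_of_lt_of_nonneg hx ha

theorem completelyMonotonicOn_const_mul_inv_pow (c : ℝ) (i j k l : ℕ) (hc : 0 ≤ c := by norm_num) :
    CompletelyMonotonicOn (fun x => c * (x⁻¹ ^ i * (x + 1)⁻¹ ^ j * (x + 2)⁻¹ ^ k * (x + 3)⁻¹ ^ l))
      (Ioi 0) := by
  have hI := uniqueDiffOn_Ioi (0 : ℝ)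
  exact ((((completelyMonotonicOn_inv.pow hI i).mul hI
    ((completelyMonotonicOn_inv_add zero_le_one).pow hI j)).mul hI
    ((completelyMonotonicOn_inv_add zero_le_two).pow hI k)).mul hI
    ((completelyMonotonicOn_inv_add zero_le_three).pow hI l)).const_mul hc

theorem hasDerivAt_log_Gamma {x : ℝ} (hx : 0 < x) :
    HasDerivAt (Real.log ∘ Real.Gamma) (psi x) x :=
  (Real.differentiableOn_Gamma_Ioi.differentiableAt (Ioi_mem_nhds hx)).hasDerivAt.log
    (Real.Gamma_pos_of_pos hx).ne'

theorem log_Gamma_add_one {x : ℝ} (hx : 0 < x) :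
    Real.log (Real.Gamma (x + 1)) = Real.log (Real.Gamma x) + Real.log x := by
  rw [Real.Gamma_add_one hx.ne', Real.log_mul hx.ne' (Real.Gamma_pos_of_pos hx).ne', add_comm]

theorem psi_add_one {x : ℝ} (hx : 0 < x) : psi (x + 1) = psi x + x⁻¹ := by
  have shifted := (hasDerivAt_log_Gamma (add_pos hx one_pos)).comp_add_const x 1
  refine shifted.unique
    (((hasDerivAt_log_Gamma hx).add (Real.hasDerivAt_log hx.ne')).congr_of_eventuallyEq ?_)
  filter_upwards [Ioi_mem_nhds hx] with y hy using log_Gamma_add_one hy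

theorem slope_log_Gamma_add_one {x : ℝ} (hx : 0 < x) :
    slope (Real.log ∘ Real.Gamma) x (x + 1) = Real.log x := by
  simp [slope_def_field, log_Gamma_add_one hx]

theorem psi_le_log {x : ℝ} (hx : 0 < x) : psi x ≤ Real.log x := by
  rw [← slope_log_Gamma_add_one hx]
  exact Real.convexOn_log_Gamma.le_slope_of_hasDerivAt hx (add_pos hx one_pos) (lt_add_one x)
    (hasDerivAt_log_Gamma hx)

theorem log_sub_psi_le_inv {x : ℝ} (hx : 0 < x) : Real.log x - psi x ≤ x⁻¹ := by
  rw [sub_le_iff_le_add', ← psi_add_one hx, ← slope_log_Gamma_add_one hx]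
  exact Real.convexOn_log_Gamma.slope_le_of_hasDerivAt hx (add_pos hx one_pos) (lt_add_one x)
    (hasDerivAt_log_Gamma (add_pos hx one_pos))

theorem tendsto_log_sub_psi_atTop : Tendsto (fun x => Real.log x - psi x) atTop (𝓝 0) := by
  refine squeeze_zero' ?_ ?_ tendsto_inv_atTop_zero <;>
    filter_upwards [eventually_gt_atTop 0] with x hx
  exacts [sub_nonneg.2 (psi_le_log hx), log_sub_psi_le_inv hx]

theorem log_add_one_sub_log_le_inv {x : ℝ} (hx : 0 < x) :
    Real.log (x + 1) - Real.log x ≤ x⁻¹ := by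
  have hx1 := add_pos hx one_pos
  rw [← Real.log_div hx1.ne' hx.ne']
  refine (Real.log_le_sub_one_of_pos (div_pos hx1 hx)).trans_eq ?_
  field_simp
  ring

theorem completelyMonotonicOn_inv_sub_log :
    CompletelyMonotonicOn (fun x => x⁻¹ - (Real.log (x + 1) - Real.log x)) (Ioi 0) := by
  refine .of_hasDerivAt_neg isOpen_Ioi (fun x (hx : 0 < x) => ?_)
    (fun x hx => sub_nonneg.2 (log_add_one_sub_log_le_inv hx))
    (completelyMonotonicOn_const_mul_inv_pow 1 2 1 0 0)
  have shifted := (Real.hasDerivAt_log (add_pos hx one_pos).ne').comp_add_const x 1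
  refine ((hasDerivAt_inv hx.ne').sub
    (shifted.sub (Real.hasDerivAt_log hx.ne'))).congr_deriv ?_
  field_simp
  ring

theorem completelyMonotonicOn_log_sub_psi :
    CompletelyMonotonicOn (fun x => Real.log x - psi x) (Ioi 0) := by
  refine .of_sub_shift tendsto_log_sub_psi_atTop
    (completelyMonotonicOn_inv_sub_log.congr fun x hx => ?_)
  simp only [psi_add_one hx]
  ring

theorem differentiableAt_psi {x : ℝ} (hx : 0 < x) : DifferentiableAt ℝ psi x := by
  have h := (Real.differentiableAt_log hx.ne').sub
    (completelyMonotonicOn_log_sub_psi.hasDerivAt isOpen_Ioi hx).differentiableAt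
  exact h.congr_of_eventuallyEq (.of_forall fun y => (sub_sub_cancel (Real.log y) (psi y)).symm)

theorem deriv_psi_eq_neg_deriv_add_inv {x : ℝ} (hx : 0 < x) :
    deriv psi x = -deriv (fun y => Real.log y - psi y) x + x⁻¹ := by
  rw [deriv_fun_sub (Real.differentiableAt_log hx.ne') (differentiableAt_psi hx), Real.deriv_log]
  ring

theorem deriv_psi_sub_shift {x : ℝ} (hx : 0 < x) :
    deriv psi x - deriv psi (x + 1) = 1 / x ^ 2 := by
  have shifted := (differentiableAt_psi (add_pos hx one_pos)).hasDerivAt.comp_add_const x 1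
  have deriv_eq := shifted.unique
    (((differentiableAt_psi hx).hasDerivAt.add (hasDerivAt_inv hx.ne')).congr_of_eventuallyEq (by
      filter_upwards [Ioi_mem_nhds hx] with y hy using psi_add_one hy))
  rw [deriv_eq, one_div]
  ring

theorem completelyMonotonicOn_deriv_psi : CompletelyMonotonicOn (deriv psi) (Ioi 0) :=
  ((completelyMonotonicOn_log_sub_psi.neg_deriv isOpen_Ioi).add (uniqueDiffOn_Ioi 0)
    completelyMonotonicOn_inv).congr fun _ hx => deriv_psi_eq_neg_deriv_add_inv hx

theorem tendsto_deriv_psi_atTop : Tendsto (deriv psi) atTop (𝓝 0) := by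
  have h := completelyMonotonicOn_log_sub_psi.tendsto_deriv_atTop.neg.add tendsto_inv_atTop_zero
  rw [neg_zero, zero_add] at h
  refine h.congr' ?_
  filter_upwards [eventually_gt_atTop 0] with x hx using (deriv_psi_eq_neg_deriv_add_inv hx).symm

/-- The coefficient of `-λ` in `trigammaDiff λ`. -/
noncomputable def trigammaWeight (x : ℝ) : ℝ :=
  (4 + 8 * x + 5 * x ^ 2) / (24 * x * (1 + x) ^ 3 * (2 + x) ^ 2)

theorem trigammaDiff_eq_sub (mu lam x : ℝ) :
    trigammaDiff lam x = trigammaDiff mu x - (lam - mu) * trigammaWeight x := by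
  simp only [trigammaDiff, trigammaWeight]
  ring

theorem completelyMonotonicOn_trigammaWeight : CompletelyMonotonicOn trigammaWeight (Ioi 0) := by
  have hI := uniqueDiffOn_Ioi (0 : ℝ)
  refine (((completelyMonotonicOn_const_mul_inv_pow (1 / 6) 1 3 2 0).add hI
    (completelyMonotonicOn_const_mul_inv_pow (1 / 8) 0 3 2 0)).add hI
    (completelyMonotonicOn_const_mul_inv_pow (5 / 24) 0 2 2 0)).congr fun x (hx : 0 < x) => ?_
  rw [trigammaWeight]
  field_simp
  ring

theorem trigammaDiff_sub_shift (lam : ℝ) {x : ℝ} (hx : 0 < x) :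
    trigammaDiff lam x - trigammaDiff lam (x + 1) =
      ((4 - lam) * ((72 + 211 * x + 238 * x ^ 2 + 115 * x ^ 3 + 20 * x ^ 4) * (1 + x) * (2 + x))
        - (576 + 2244 * x + 3708 * x ^ 2 + 2944 * x ^ 3 + 1116 * x ^ 4 + 164 * x ^ 5)) /
      (24 * x * (1 + x) ^ 4 * (2 + x) ^ 4 * (3 + x) ^ 2) := by
  rw [trigammaDiff, trigammaDiff, eq_add_of_sub_eq (deriv_psi_sub_shift hx),
    show 1 + (x + 1) = 2 + x by ring, show 2 + (x + 1) = 3 + x by ring, add_comm x 1]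
  field_simp
  ring

theorem tendsto_trigammaDiff_atTop (lam : ℝ) : Tendsto (trigammaDiff lam) atTop (𝓝 0) := by
  have rational_part := tendsto_atTop_of_eq_comp_inv
    (f := fun x => trigammaDiff lam x - deriv psi x)
    (φ := fun y : ℝ => -(lam * y ^ 4 * (4 * y ^ 2 + 8 * y + 5) /
        (24 * (y + 1) ^ 3 * (2 * y + 1) ^ 2))
      - y * (24 * y ^ 7 + 120 * y ^ 6 + 283 * y ^ 5 + 399 * y ^ 4 + 345 * y ^ 3 + 181 * y ^ 2
        + 51 * y + 6) / (6 * (y + 1) ^ 4 * (2 * y + 1) ^ 2))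
    (.sub (.neg (.div (by fun_prop) (by fun_prop) (by norm_num)))
      (.div (by fun_prop) (by fun_prop) (by norm_num)))
    (fun x hx => by
      rw [trigammaDiff]
      field_simp
      ring)
  simpa using rational_part.add tendsto_deriv_psi_atTop

theorem completelyMonotonicOn_trigammaDiff_zero :
    CompletelyMonotonicOn (trigammaDiff 0) (Ioi 0) := by
  have hI := uniqueDiffOn_Ioi (0 : ℝ)
  refine .of_sub_shift (tendsto_trigammaDiff_atTop 0) ?_
  -- With `t = 1 + x`, the difference is
  -- `(20t⁵ + 34t⁴ + 8t³ - 9t² + 12t + 12) / (6t⁴(1+t)⁴(2+t)²)`. Extending the fraction by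
  -- `(1+t)(2+t)` makes every coefficient of the numerator positive; the part divisible by `t⁴` is
  -- then expanded in powers of `1 + t`.
  refine ((((((((completelyMonotonicOn_const_mul_inv_pow 4 0 4 5 3).add hI
    (completelyMonotonicOn_const_mul_inv_pow 10 0 3 5 3)).add hI
    (completelyMonotonicOn_const_mul_inv_pow 5 0 2 5 3)).add hI
    (completelyMonotonicOn_const_mul_inv_pow (1 / 6) 0 1 5 3)).add hI
    (completelyMonotonicOn_const_mul_inv_pow (7 / 6) 0 0 5 3)).add hI
    (completelyMonotonicOn_const_mul_inv_pow (11 / 3) 0 0 4 3)).add hI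
    (completelyMonotonicOn_const_mul_inv_pow (17 / 3) 0 0 3 3)).add hI
    (completelyMonotonicOn_const_mul_inv_pow (10 / 3) 0 0 2 3)).congr fun x (hx : 0 < x) => ?_
  rw [trigammaDiff_sub_shift 0 hx]
  field_simp
  ring

theorem completelyMonotonicOn_neg_trigammaDiff_four :
    CompletelyMonotonicOn (fun x => -trigammaDiff 4 x) (Ioi 0) := by
  have hI := uniqueDiffOn_Ioi (0 : ℝ)
  refine .of_sub_shift (by simpa using (tendsto_trigammaDiff_atTop 4).neg) ?_
  -- Over `24x(1+x)⁴(2+x)⁴(3+x)²`, split off the constant term of the numerator, cancel `x` in the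
  -- rest and expand it in powers of `1 + x`.
  refine ((((((completelyMonotonicOn_const_mul_inv_pow 24 1 4 4 2).add hI
    (completelyMonotonicOn_const_mul_inv_pow 22 0 4 4 2)).add hI
    (completelyMonotonicOn_const_mul_inv_pow (64 / 3) 0 3 4 2)).add hI
    (completelyMonotonicOn_const_mul_inv_pow (145 / 6) 0 2 4 2)).add hI
    (completelyMonotonicOn_const_mul_inv_pow (115 / 6) 0 1 4 2)).add hI
    (completelyMonotonicOn_const_mul_inv_pow (41 / 6) 0 0 4 2)).congr fun x (hx : 0 < x) => ?_
  rw [neg_sub_neg, ← neg_sub, trigammaDiff_sub_shift 4 hx]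
  field_simp
  ring

theorem mul_trigammaDiff (lam : ℝ) {x : ℝ} (hx : 0 < x) :
    x * trigammaDiff lam x = x * deriv psi (x + 1)
      - lam * (4 + 8 * x + 5 * x ^ 2) / (24 * (1 + x) ^ 3 * (2 + x) ^ 2)
      - x * (37 + 135 * x + 189 * x ^ 2 + 133 * x ^ 3 + 45 * x ^ 4 + 6 * x ^ 5) /
        (6 * (1 + x) ^ 4 * (2 + x) ^ 2) := by
  rw [trigammaDiff, eq_add_of_sub_eq (deriv_psi_sub_shift hx)]
  field_simp
  ring

theorem tendsto_mul_trigammaDiff_nhdsGT_zero (lam : ℝ) :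
    Tendsto (fun x => x * trigammaDiff lam x) (𝓝[>] 0) (𝓝 (-lam / 24)) := by
  have deriv_psi_shift : ContinuousAt (fun x => deriv psi (x + 1)) 0 :=
    ContinuousAt.comp (g := deriv psi) (completelyMonotonicOn_deriv_psi.1.continuousOn.continuousAt
      (Ioi_mem_nhds (by norm_num))) (by fun_prop)
  have continuousAt_zero : ContinuousAt (fun x : ℝ => x * deriv psi (x + 1)
      - lam * (4 + 8 * x + 5 * x ^ 2) / (24 * (1 + x) ^ 3 * (2 + x) ^ 2)
      - x * (37 + 135 * x + 189 * x ^ 2 + 133 * x ^ 3 + 45 * x ^ 4 + 6 * x ^ 5) /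
        (6 * (1 + x) ^ 4 * (2 + x) ^ 2)) 0 :=
    ((continuousAt_id.mul deriv_psi_shift).sub
      (.div (by fun_prop) (by fun_prop) (by norm_num))).sub
      (.div (by fun_prop) (by fun_prop) (by norm_num))
  convert (continuousAt_zero.tendsto.mono_left nhdsWithin_le_nhds).congr' ?_ using 2
  · norm_num
    ring
  · filter_upwards [self_mem_nhdsWithin] with x hx using (mul_trigammaDiff lam hx).symm

theorem nonpos_of_trigammaDiff_nonneg {lam : ℝ} (h : ∀ x, 0 < x → 0 ≤ trigammaDiff lam x) :
    lam ≤ 0 := by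
  have limit_nonneg : 0 ≤ -lam / 24 := by
    refine ge_of_tendsto (tendsto_mul_trigammaDiff_nhdsGT_zero lam) ?_
    filter_upwards [self_mem_nhdsWithin] with x hx using mul_nonneg (le_of_lt hx) (h x hx)
  linarith

theorem tendsto_pow_five_mul_trigammaDiff_sub_shift_atTop (lam : ℝ) :
    Tendsto (fun x => x ^ 5 * (trigammaDiff lam x - trigammaDiff lam (x + 1))) atTop
      (𝓝 (5 / 6 * (4 - lam))) := by
  convert tendsto_atTop_of_eq_comp_inv (φ := fun y : ℝ =>
    ((4 - lam) * ((72 * y ^ 4 + 211 * y ^ 3 + 238 * y ^ 2 + 115 * y + 20) * (y + 1) * (2 * y + 1))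
      - y * (576 * y ^ 5 + 2244 * y ^ 4 + 3708 * y ^ 3 + 2944 * y ^ 2 + 1116 * y + 164)) /
      (24 * (y + 1) ^ 4 * (2 * y + 1) ^ 4 * (3 * y + 1) ^ 2))
    (.div (by fun_prop) (by fun_prop) (by norm_num)) fun x hx => ?_ using 2
  · norm_num
    ring
  · rw [trigammaDiff_sub_shift lam hx]
    field_simp

theorem four_le_of_trigammaDiff_nonpos {lam : ℝ} (h : ∀ x, 0 < x → trigammaDiff lam x ≤ 0) :
    4 ≤ lam := by
  by_contra! hlam
  have limit_pos : 0 < 5 / 6 * (4 - lam) := mul_pos (by norm_num) (sub_pos.2 hlam)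
  obtain ⟨a, ha⟩ := eventually_atTop.1
    ((tendsto_pow_five_mul_trigammaDiff_sub_shift_atTop lam).eventually_const_lt limit_pos)
  have shift_lt : ∀ y, max a 1 ≤ y → trigammaDiff lam (y + 1) < trigammaDiff lam y := by
    intro y hy
    have hy_pos : 0 < y := one_pos.trans_le ((le_max_right a 1).trans hy)
    exact sub_pos.1 (pos_of_mul_pos_right (ha y ((le_max_left a 1).trans hy)) (by positivity))
  exact (h _ (by positivity)).not_gt
    (pos_of_forall_shift_lt (tendsto_trigammaDiff_atTop lam) shift_lt)

theorem mainTheorem2 (lam : ℝ) :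
    (CompletelyMonotonicOn (trigammaDiff lam) (Set.Ioi 0) ↔ lam ≤ 0) ∧
    (CompletelyMonotonicOn (fun x => -trigammaDiff lam x) (Set.Ioi 0) ↔ 4 ≤ lam) := by
  have hI := uniqueDiffOn_Ioi (0 : ℝ)
  refine ⟨⟨fun h => ?_, fun h => ?_⟩, ⟨fun h => ?_, fun h => ?_⟩⟩
  · exact nonpos_of_trigammaDiff_nonneg fun x hx => h.nonneg hx
  · refine (completelyMonotonicOn_trigammaDiff_zero.add hI
      (completelyMonotonicOn_trigammaWeight.const_mul (neg_nonneg.2 h))).congr fun x _ => ?_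
    rw [trigammaDiff_eq_sub 0 lam]
    ring
  · exact four_le_of_trigammaDiff_nonpos fun x hx => neg_nonneg.1 (h.nonneg hx)
  · refine (completelyMonotonicOn_neg_trigammaDiff_four.add hI
      (completelyMonotonicOn_trigammaWeight.const_mul (sub_nonneg.2 h))).congr fun x _ => ?_
    rw [trigammaDiff_eq_sub 4 lam]
    ring
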